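/- Let $k<N$ be nonnegative integers, $0<\epsilon,\delta<1/2$, and put $$d_0(N,k,\epsilon,\delta)=\max\left\{\frac{2k}{\epsilon},\ \frac{24}{\epsilon^2}\left(\frac{\log(3/\delta)}{\log N}+1\right)(\log N+1)+k-1\right\}$$ (natural logarithms; in the trivial case $N=1$, $k=0$ the quotient $\log(3/\delta)/\log N$ is read as $0$). For quality scores $q_1,\dots,q_N\ge 0$ and a $D\times N$ real matrix $\phi$ with columns (diversity features) $\phi_1,\dots,\phi_N\in\mathbb R^D$, let $L_{ij}=q_i\,\phi_i^\top\phi_j\,q_j$, let $\mathcal P(Y)=\det(L_Y)/\det(L+I)$, $Y\subseteq\{1,\dots,N\}$, be the determinantal point process (DPP) with L-ensemble kernel $L$, and let $\mathcal P^{\le k}$ be $\mathcal P$ conditioned on the event that the random set has at most $k$ elements, so that, for $|Y|\le k$, with $\phi(Y)$ the matrix of the columns $\phi_i$, $i\in Y$, $$\mathcal P^{\le k}(Y)=\frac{\left(\prod_{i\in Y}q_i^2\right)\det(\phi(Y)^\top\phi(Y))}{\sum_{|Y'|\le k}\left(\prod_{i\in Y'}q_i^2\right)\det(\phi(Y')^\top\phi(Y'))},$$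 and $\mathcal P^{\le k}(Y)=0$ for $|Y|>k$. Let $d\ge d_0(N,k,\epsilon,\delta)$ be an integer, let $G$ be a $d\times D$ random matrix with independent entries of law $\mathcal N(0,1/d)$, and let $\tilde{\mathcal P}^{\le k}$ be the cardinality-conditioned DPP defined by the same $q$ and the projected features $G\phi_1,\dots,G\phi_N$. Then, with probability at least $1-\delta$, $$\big\|\mathcal P^{\le k}-\tilde{\mathcal P}^{\le k}\big\|_1=\sum_{Y\subseteq\{1,\dots,N\}}\big|\mathcal P^{\le k}(Y)-\tilde{\mathcal P}^{\le k}(Y)\big|\le e^{6k\epsilon}-1 .$$ Moreover, the required dimension satisfies $\lceil d_0(N,k,\epsilon,\delta)\rceil\le C\max\{k/\epsilon,\ (\log(1/\delta)+\log N)/\epsilon^2\}$ with an absolute constant $C$. -/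

import Mathlib

open MeasureTheory ProbabilityTheory

noncomputable section

namespace DPP

/-- The kernel `L i j = q i * ⟪φ i, φ j⟫ * q j` of the quality/diversity decomposition; the diversity
feature vectors `φ i` are the columns of the matrix `Φ`. -/
def kernel {m ι : Type*} [Fintype m] (q : ι → ℝ) (Φ : Matrix m ι ℝ) : Matrix ι ι ℝ :=
  Matrix.of fun i j => q i * (Φ.transpose * Φ) i j * q j

/-- The probability `det L_Y / det (L + I)` that the L-ensemble DPP with kernel `L` gives to the
set `Y`, where `L_Y` is the principal submatrix of `L` with rows and columns in `Y`. -/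
def prob {ι : Type*} [Fintype ι] [DecidableEq ι] (L : Matrix ι ι ℝ) (Y : Finset ι) : ℝ :=
  (L.submatrix (fun i : Y => (i : ι)) (fun i : Y => (i : ι))).det / (L + 1).det

/-- Conditioning a distribution `P` on subsets on the event that the cardinality is at most `k`. -/
def condCardLe {ι : Type*} [Fintype ι] (k : ℕ) (P : Finset ι → ℝ) (Y : Finset ι) : ℝ :=
  if Y.card ≤ k then P Y / ∑ Y' : Finset ι with Y'.card ≤ k, P Y' else 0

/-- The cardinality-conditioned DPP with quality model `q` and diversity features the columns
of `Φ`. -/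
def condDPP {m ι : Type*} [Fintype m] [Fintype ι] [DecidableEq ι] (k : ℕ) (q : ι → ℝ)
    (Φ : Matrix m ι ℝ) : Finset ι → ℝ :=
  condCardLe k (prob (kernel q Φ))

/-- The `L¹` distance between two real functions on a finite type. -/
def l1Dist {α : Type*} [Fintype α] (P Q : α → ℝ) : ℝ :=
  ∑ a, |P a - Q a|

/-- The projection dimension (a real number, to be rounded up to an integer). -/
def projDim (N k : ℕ) (ε δ : ℝ) : ℝ :=
  max (2 * k / ε)
    (24 / ε ^ 2 * (Real.log (3 / δ) / Real.log N + 1) * (Real.log N + 1) + k - 1)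

/-- `G` is a random `d × D` matrix on the probability space `(Ω, μ)` with independent entries of
law `N(0, 1/d)`. -/
def IsGaussianProjection {Ω : Type*} [MeasurableSpace Ω] (μ : Measure Ω) {d D : ℕ}
    (G : Ω → Matrix (Fin d) (Fin D) ℝ) : Prop :=
  (∀ i j, HasLaw (fun ω => G ω i j) (gaussianReal 0 (1 / d)) μ) ∧
    iIndepFun (fun (p : Fin d × Fin D) ω => G ω p.1 p.2) μ

/-- The unnormalised weight `(∏ i ∈ Y, q i ^ 2) * det (φ(Y)ᵀ φ(Y))`. -/
def weight {m ι : Type*} [Fintype m] [DecidableEq ι] (q : ι → ℝ) (Φ : Matrix m ι ℝ)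
    (Y : Finset ι) : ℝ :=
  (∏ i ∈ Y, q i ^ 2) *
    ((Φ.submatrix id (fun i : Y => (i : ι))).transpose *
      Φ.submatrix id (fun i : Y => (i : ι))).det

theorem det_kernel_submatrix {m ι : Type*} [Fintype m] [DecidableEq ι] (q : ι → ℝ)
    (Φ : Matrix m ι ℝ) (Y : Finset ι) :
    ((kernel q Φ).submatrix (fun i : Y => (i : ι)) (fun i : Y => (i : ι))).det =
      weight q Φ Y := by
  have h : (kernel q Φ).submatrix (fun i : Y => (i : ι)) (fun i : Y => (i : ι)) =
      Matrix.diagonal (fun i : Y => q i) *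
        ((Φ.submatrix id (fun i : Y => (i : ι))).transpose *
          Φ.submatrix id (fun i : Y => (i : ι))) * Matrix.diagonal (fun i : Y => q i) := by
    ext i j
    rw [Matrix.mul_diagonal, Matrix.diagonal_mul]
    simp [kernel, Matrix.mul_apply]
  rw [h, Matrix.det_mul, Matrix.det_mul, Matrix.det_diagonal, weight, Finset.prod_coe_sort Y q,
    Finset.prod_pow]
  ring

theorem det_kernel_add_one_pos {m ι : Type*} [Fintype m] [Fintype ι] [DecidableEq ι] (q : ι → ℝ)
    (Φ : Matrix m ι ℝ) : 0 < (kernel q Φ + 1).det := by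
  have h : kernel q Φ = (Φ * Matrix.diagonal q).conjTranspose * (Φ * Matrix.diagonal q) := by
    ext i j
    rw [kernel, Matrix.of_apply, Matrix.mul_apply, Matrix.mul_apply, Finset.mul_sum,
      Finset.sum_mul]
    refine Finset.sum_congr rfl fun x _ => ?_
    rw [Matrix.conjTranspose_apply, Matrix.mul_diagonal, Matrix.mul_diagonal,
      Matrix.transpose_apply, star_trivial]
    ring
  rw [h]
  exact (Matrix.PosDef.posSemidef_add (Matrix.posSemidef_conjTranspose_mul_self _)
    Matrix.PosDef.one).det_pos

/-- The conditioned DPP in terms of quality and diversity. -/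
theorem condDPP_eq {m ι : Type*} [Fintype m] [Fintype ι] [DecidableEq ι] (k : ℕ) (q : ι → ℝ)
    (Φ : Matrix m ι ℝ) (Y : Finset ι) :
    condDPP k q Φ Y =
      if Y.card ≤ k then weight q Φ Y / ∑ Y' : Finset ι with Y'.card ≤ k, weight q Φ Y'
      else 0 := by
  have h := (det_kernel_add_one_pos q Φ).ne'
  simp only [condDPP, condCardLe, prob, det_kernel_submatrix, ← Finset.sum_div]
  rw [div_div_div_cancel_right₀ h]

end DPP

end

noncomputable section

namespace DPP

open scoped NNReal ENNReal

/-! The weight of `Y` is a factor depending only on `q` times the squared volume `sqVol Φ Y`, so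
only volumes change under the projection. If every squared volume with `Y.card ≤ k` changes by a
factor within `exp (±a)`, so does the normalising sum; probabilities then change by a factor within
`exp (±2a)`, and the L¹ distance is at most `exp (2a) - 1`. The theorem takes `a = 3kε`
(`l1Dist_condDPP_le`).

For linearly independent columns, the ratio of projected to original squared volume is distributed
as the Gram determinant of `Y.card` independent Gaussian vectors in `ℝ^d`
(`exists_orthonormal_factor`, `IsGaussianProjection.map_mul`). By base times height (`gramDet_cons`)
and rotation invariance, its moments are controlled by products of moments of squared norms of
Gaussian vectors in dimensions `d - r`, `r < Y.card`. These are Gamma quotients; for orders `±t`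
with `8t ≤ dε`, each is at most `exp (2εt)`. Markov's inequality at level `exp (3|Y|εt)` bounds both
tails by `exp (-εt|Y|)`.

The failure probability is thus at most `2 y ^ |Y|` with `y = exp (-dε²/24)`. This geometric decay
offsets the number of subsets: the union bound costs at most `2((1 + y)^N - 1)`, so `yN ≤ δ/3`
suffices, without a term of order `k log N / ε²` in the dimension. Empty sets and dependent columns
need no probability: their squared volumes stay 1 and 0. -/

/-! ### Gaussian vectors: rotation invariance and moments of the squared norm -/

/-- The law of a vector of independent centred Gaussians of variance `v`. -/
def gaussPi (ι : Type*) [Fintype ι] (v : ℝ≥0) : Measure (ι → ℝ) :=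
  Measure.pi fun _ => gaussianReal 0 v

instance (ι : Type*) [Fintype ι] (v : ℝ≥0) : IsProbabilityMeasure (gaussPi ι v) := by
  unfold gaussPi; infer_instance

theorem charFun_gaussPi {ι : Type*} [Fintype ι] (v : ℝ≥0) (t : EuclideanSpace ℝ ι) :
    charFun ((gaussPi ι v).map (WithLp.toLp 2)) t = Complex.exp (-(v * ∑ i, t i ^ 2 : ℝ) / 2) := by
  simp_rw [gaussPi, charFun_pi, charFun_gaussianReal, ← Complex.exp_sum]
  congr 1
  push_cast
  rw [Finset.mul_sum, ← Finset.sum_neg_distrib, Finset.sum_div]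
  refine Finset.sum_congr rfl fun i _ => ?_
  simp [neg_div]

/-- The characteristic function depends only on the Euclidean norm of its argument, which
`A.transpose` preserves. `A` need not be square, so orthogonal projections onto subspaces are
covered. -/
theorem gaussPi_map_mulVec {ι κ : Type*} [Fintype ι] [Fintype κ] [DecidableEq κ] (v : ℝ≥0)
    (A : Matrix κ ι ℝ) (hA : A * A.transpose = 1) :
    (gaussPi ι v).map (fun x => A.mulVec x) = gaussPi κ v := by
  have hm : Measurable (fun x : ι → ℝ => A.mulVec x) := by
    refine measurable_pi_lambda _ fun i => ?_
    simp only [Matrix.mulVec, dotProduct]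
    fun_prop
  have hme := (MeasurableEquiv.toLp 2 (κ → ℝ)).map_measurableEquiv_injective
  apply hme
  have : IsProbabilityMeasure ((gaussPi ι v).map (fun x => A.mulVec x)) :=
    Measure.isProbabilityMeasure_map hm.aemeasurable
  have i1 : IsProbabilityMeasure (((gaussPi ι v).map (fun x => A.mulVec x)).map
    (MeasurableEquiv.toLp 2 (κ → ℝ))) :=
    Measure.isProbabilityMeasure_map (MeasurableEquiv.measurable _).aemeasurable
  have i2 : IsProbabilityMeasure ((gaussPi κ v).map (MeasurableEquiv.toLp 2 (κ → ℝ))) :=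
    Measure.isProbabilityMeasure_map (MeasurableEquiv.measurable _).aemeasurable
  apply Measure.ext_of_charFun (E := EuclideanSpace ℝ κ)
  ext t
  have h1 := charFun_gaussPi v t
  have h2 := charFun_gaussPi (ι := ι) v (WithLp.toLp 2 (A.transpose.mulVec t.ofLp))
  rw [charFun_apply, integral_map (by fun_prop) (by fun_prop)] at h2
  rw [MeasurableEquiv.coe_toLp, h1, charFun_apply, integral_map (by fun_prop) (by fun_prop),
    integral_map (by fun_prop) (by fun_prop)]
  have e1 : ∀ x : ι → ℝ, inner ℝ (WithLp.toLp 2 (A.mulVec x)) t =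
      inner ℝ (WithLp.toLp 2 x) (WithLp.toLp 2 (A.transpose.mulVec t.ofLp)) := fun x => by
    simp only [EuclideanSpace.inner_eq_star_dotProduct, star_trivial]
    rw [Matrix.mulVec_transpose, ← Matrix.dotProduct_mulVec]
  have e2 : ∑ i, A.transpose.mulVec t.ofLp i ^ 2 = ∑ i, t i ^ 2 := by
    rw [show ∑ i, A.transpose.mulVec t.ofLp i ^ 2 =
      A.transpose.mulVec t.ofLp ⬝ᵥ A.transpose.mulVec t.ofLp by simp [dotProduct, sq],
      show ∑ i, t i ^ 2 = t.ofLp ⬝ᵥ t.ofLp by simp [dotProduct, sq],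
      Matrix.dotProduct_mulVec, Matrix.vecMul_transpose, Matrix.mulVec_mulVec, hA,
      Matrix.one_mulVec]
  simp only [e1]
  rw [h2]
  simp only [e2]

theorem gaussPi_eq_withDensity (n : ℕ) {v : ℝ≥0} (hv : v ≠ 0) :
    gaussPi (Fin n) v = (volume : Measure (Fin n → ℝ)).withDensity
      fun x => ∏ i, gaussianPDF 0 v (x i) := by
  refine Measure.pi_eq fun s hs => ?_
  rw [withDensity_apply _ (MeasurableSet.univ_pi hs), volume_pi, Measure.restrict_pi_pi]
  -- General factors are needed because the measures here are restrictions of Lebesgue measure to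
  -- the sides of a box.
  have : ∀ n (μ : Fin n → Measure ℝ) [∀ i, SigmaFinite (μ i)],
      ∫⁻ x, ∏ i, gaussianPDF 0 v (x i) ∂(Measure.pi μ) = ∏ i, ∫⁻ x, gaussianPDF 0 v x ∂(μ i) := by
    intro n
    induction n with
    | zero => intro μ _; simp
    | succ n ih =>
      intro μ _
      rw [← ((measurePreserving_piFinSuccAbove μ 0).symm).lintegral_comp_emb
        (MeasurableEquiv.measurableEmbedding _)]
      simp_rw [MeasurableEquiv.piFinSuccAbove_symm_apply, Fin.insertNthEquiv,
            Fin.prod_univ_succ, Fin.insertNth_zero, Equiv.coe_fn_mk, Fin.cons_succ,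
            Fin.zero_succAbove, Fin.cons_zero]
      rw [← ih, ← lintegral_prod_mul]
      · rfl
      · exact (measurable_gaussianPDF _ _).aemeasurable
      · exact (Finset.measurable_prod _ fun i _ =>
          (measurable_gaussianPDF _ _).comp (measurable_pi_apply i)).aemeasurable
  rw [this]
  refine Finset.prod_congr rfl fun i _ => ?_
  rw [gaussianReal_of_var_ne_zero _ hv, withDensity_apply _ (hs i)]

/-- Polar coordinates turn the moment into a Gamma integral. The constant `K` is the same for all
`p`, so it need not be computed: the case `p = 0`, total mass 1, determines it afterwards. -/
theorem lintegral_gaussPi_radial {n : ℕ} (hn : n ≠ 0) {v : ℝ≥0} (hv : v ≠ 0) :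
    ∃ K : ℝ, 0 ≤ K ∧ ∀ p : ℝ, 0 < (n : ℝ) / 2 + p →
      ∫⁻ x, ENNReal.ofReal (∑ i, x i ^ 2) ^ p ∂gaussPi (Fin n) v =
        ENNReal.ofReal (K * ((2 * v) ^ p * Real.Gamma (n / 2 + p))) := by
  have hv' : (0 : ℝ) < v := by positivity
  have : Nonempty (Fin n) := ⟨⟨0, Nat.pos_of_ne_zero hn⟩⟩
  set c : ℝ := (√(2 * Real.pi * v))⁻¹ ^ n with hc
  have hc0 : 0 < c := by positivity
  set ω : ℝ := (volume : Measure (EuclideanSpace ℝ (Fin n))).real (Metric.ball 0 1) with hω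
  refine ⟨n * ω * c * ((2 * v : ℝ) ^ ((n : ℝ) / 2) * (1 / 2)), by positivity, fun p hp => ?_⟩
  set f : ℝ → ℝ := fun r => c * (r ^ (2 * p) * Real.exp (-(1 / (2 * v)) * r ^ (2 : ℝ))) with hf
  have hf0 : ∀ r, 0 ≤ r → 0 ≤ f r := fun r hr => by positivity
  have hdens : ∀ x : Fin n → ℝ, ∏ i, gaussianPDF 0 v (x i) =
      ENNReal.ofReal (c * Real.exp (-(1 / (2 * v)) * ∑ i, x i ^ 2)) := fun x => by
    simp only [gaussianPDF]
    rw [← ENNReal.ofReal_prod_of_nonneg fun i _ => gaussianPDFReal_nonneg _ _ _]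
    simp only [gaussianPDFReal, Finset.prod_mul_distrib, ← Real.exp_sum]
    congr 2
    · simp [hc]
    · rw [Finset.mul_sum]
      congr 1
      refine Finset.sum_congr rfl fun i _ => ?_
      field_simp
      ring
  have hpt : ∀ y : EuclideanSpace ℝ (Fin n), y ≠ 0 →
      (∏ i, gaussianPDF 0 v (y i)) * ENNReal.ofReal (∑ i, y i ^ 2) ^ p =
        ENNReal.ofReal (f ‖y‖) := fun y hy => by
    have hy' : 0 < ‖y‖ := norm_pos_iff.2 hy
    rw [hdens, ← EuclideanSpace.real_norm_sq_eq, ENNReal.ofReal_rpow_of_pos (by positivity),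
      ← ENNReal.ofReal_mul (by positivity), hf]
    congr 1
    simp only [Real.rpow_mul hy'.le, Real.rpow_two]
    ring
  have hint0 : IntegrableOn (fun r : ℝ => r ^ ((n : ℝ) - 1 + 2 * p) *
      Real.exp (-(1 / (2 * v)) * r ^ (2 : ℝ))) (Set.Ioi 0) :=
    integrableOn_rpow_mul_exp_neg_mul_rpow (by linarith) (by norm_num) (by positivity)
  have hrad : ∀ r ∈ Set.Ioi (0 : ℝ), r ^ (n - 1) • f r = c * (r ^ ((n : ℝ) - 1 + 2 * p) *
      Real.exp (-(1 / (2 * v)) * r ^ (2 : ℝ))) := fun r hr => by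
    have hr' : 0 < r := hr
    rw [Real.rpow_add hr', show (n : ℝ) - 1 = ((n - 1 : ℕ) : ℝ) by
      rw [Nat.cast_sub (Nat.one_le_iff_ne_zero.2 hn), Nat.cast_one], Real.rpow_natCast, hf,
      smul_eq_mul]
    ring
  have hint : Integrable (fun y : EuclideanSpace ℝ (Fin n) => f ‖y‖) := by
    rw [integrable_fun_norm_addHaar, finrank_euclideanSpace, Fintype.card_fin,
      integrableOn_congr_fun hrad measurableSet_Ioi]
    exact hint0.const_mul c
  have hval : ∫ y : EuclideanSpace ℝ (Fin n), f ‖y‖ = n * ω * c *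
      ((2 * v : ℝ) ^ ((n : ℝ) / 2) * (1 / 2)) * ((2 * v) ^ p * Real.Gamma (n / 2 + p)) := by
    rw [integral_fun_norm_addHaar, finrank_euclideanSpace, Fintype.card_fin,
      setIntegral_congr_fun measurableSet_Ioi hrad, integral_const_mul,
      integral_rpow_mul_exp_neg_mul_rpow (by norm_num) (by linarith) (by positivity),
      show ((n : ℝ) - 1 + 2 * p + 1) / 2 = n / 2 + p by ring,
      show -((n : ℝ) - 1 + 2 * p + 1) / 2 = -(n / 2 + p) by ring, one_div (2 * (v : ℝ)),
      Real.inv_rpow (by positivity), ← Real.rpow_neg (by positivity), neg_neg,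
      Real.rpow_add (by positivity), nsmul_eq_mul, smul_eq_mul]
    ring
  rw [gaussPi_eq_withDensity n hv, lintegral_withDensity_eq_lintegral_mul_non_measurable,
    ← (EuclideanSpace.volume_preserving_symm_measurableEquiv_toLp (Fin n)).lintegral_comp_emb
      (MeasurableEquiv.measurableEmbedding _), ← hval,
    ofReal_integral_eq_lintegral_ofReal hint (.of_forall fun y => hf0 _ (norm_nonneg y))]
  · refine lintegral_congr_ae ?_
    -- For negative `p` the two integrands differ at the origin, where the extended power is `∞` and
    -- the real one is 0; the origin is a null set.
    have h0 : ∀ᵐ y : EuclideanSpace ℝ (Fin n), y ≠ 0 := by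
      simp [ae_iff]
    filter_upwards [h0] with y hy
    exact hpt y hy
  · exact Finset.measurable_prod _ fun i _ =>
      (measurable_gaussianPDF _ _).comp (measurable_pi_apply i)
  · refine .of_forall fun x => ?_
    rw [hdens]
    exact ENNReal.ofReal_lt_top

theorem lintegral_gaussPi_rpow {n : ℕ} (hn : n ≠ 0) {v : ℝ≥0} (hv : v ≠ 0) {p : ℝ}
    (hp : 0 < (n : ℝ) / 2 + p) :
    ∫⁻ x, ENNReal.ofReal (∑ i, x i ^ 2) ^ p ∂gaussPi (Fin n) v =
      ENNReal.ofReal ((2 * v) ^ p * Real.Gamma (n / 2 + p) / Real.Gamma (n / 2)) := by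
  obtain ⟨K, hK, h⟩ := lintegral_gaussPi_radial hn hv
  have hn' : (0 : ℝ) < n := by positivity
  have h0 := h 0 (by positivity)
  simp only [ENNReal.rpow_zero, lintegral_one, measure_univ, Real.rpow_zero, add_zero, one_mul]
    at h0
  have h1 : K * Real.Gamma (n / 2) = 1 := by
    rw [eq_comm, ENNReal.ofReal_eq_one] at h0
    exact h0
  have hG : 0 < Real.Gamma ((n : ℝ) / 2) := Real.Gamma_pos_of_pos (by positivity)
  rw [h p hp]
  congr 1
  rw [eq_div_iff hG.ne', mul_right_comm, h1, one_mul]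

/-- By the functional equation, `Γ(x + t) / Γ(x)` is a product of `t` factors lying between `x` and
`x + t`. -/
theorem Gamma_add_natCast_le {x : ℝ} (hx : 0 < x) (t : ℕ) :
    Real.Gamma (x + t) ≤ Real.Gamma x * (x + t) ^ t := by
  induction t with
  | zero => simp
  | succ t ih =>
    have hG := Real.Gamma_pos_of_pos hx
    rw [Nat.cast_succ, ← add_assoc, Real.Gamma_add_one (by positivity), pow_succ, mul_comm,
      ← mul_assoc]
    have h : (x + t) ^ t ≤ (x + t + 1) ^ t :=
      pow_le_pow_left₀ (by positivity) (by linarith) _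
    exact mul_le_mul (ih.trans (by gcongr)) (by linarith) (by positivity) (by positivity)

theorem Gamma_mul_pow_le {x : ℝ} (hx : 0 < x) (t : ℕ) :
    Real.Gamma x * x ^ t ≤ Real.Gamma (x + t) := by
  induction t with
  | zero => simp
  | succ t ih =>
    have hG := Real.Gamma_pos_of_pos hx
    rw [Nat.cast_succ, ← add_assoc, Real.Gamma_add_one (by positivity), pow_succ, ← mul_assoc,
      mul_comm (x + t)]
    refine mul_le_mul ih (by linarith [(Nat.cast_nonneg t : (0 : ℝ) ≤ t)]) (by positivity)
      (Real.Gamma_pos_of_pos (by positivity)).le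

theorem lintegral_gaussPi_rpow_natCast_le {n : ℕ} (hn : n ≠ 0) {v : ℝ≥0} (hv : v ≠ 0) (t : ℕ) :
    ∫⁻ x, ENNReal.ofReal (∑ i, x i ^ 2) ^ (t : ℝ) ∂gaussPi (Fin n) v ≤
      ENNReal.ofReal (((v : ℝ) * (n + 2 * t)) ^ t) := by
  have hn' : (0 : ℝ) < n := by positivity
  have hG : 0 < Real.Gamma ((n : ℝ) / 2) := Real.Gamma_pos_of_pos (by positivity)
  rw [lintegral_gaussPi_rpow hn hv (by positivity)]
  refine ENNReal.ofReal_le_ofReal ?_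
  rw [div_le_iff₀ hG, Real.rpow_natCast, show (v : ℝ) * (n + 2 * t) = 2 * v * (n / 2 + t) by ring,
    mul_pow _ ((n : ℝ) / 2 + t), mul_assoc]
  gcongr
  rw [mul_comm]
  exact Gamma_add_natCast_le (by positivity) t

theorem lintegral_gaussPi_rpow_neg_natCast_le {n t : ℕ} (hn : 2 * t < n) {v : ℝ≥0} (hv : v ≠ 0) :
    ∫⁻ x, ENNReal.ofReal (∑ i, x i ^ 2) ^ (-t : ℝ) ∂gaussPi (Fin n) v ≤
      ENNReal.ofReal (((v : ℝ) * (n - 2 * t))⁻¹ ^ t) := by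
  have hn' : (0 : ℝ) < n := by exact_mod_cast (Nat.zero_le _).trans_lt hn
  have hx : (0 : ℝ) < n / 2 - t := by
    have : (2 * t : ℝ) < n := by exact_mod_cast hn
    linarith
  have hG : 0 < Real.Gamma ((n : ℝ) / 2) := Real.Gamma_pos_of_pos (by positivity)
  have hv' : (0 : ℝ) < v := by positivity
  rw [lintegral_gaussPi_rpow (by omega) hv (by linarith)]
  refine ENNReal.ofReal_le_ofReal ?_
  have h := Gamma_mul_pow_le hx t
  rw [sub_add_cancel] at h
  rw [div_le_iff₀ hG, Real.rpow_neg (by positivity), Real.rpow_natCast, inv_pow,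
    show (v : ℝ) * (n - 2 * t) = 2 * v * (n / 2 - t) by ring, mul_pow _ ((n : ℝ) / 2 - t),
    mul_inv, mul_assoc, ← sub_eq_add_neg]
  gcongr
  rwa [inv_mul_eq_div, le_div_iff₀ (by positivity)]

/-! ### Gram determinants of independent Gaussian vectors -/

/-- The Gram determinant of the rows of `W`. -/
def gramDet {κ ι : Type*} [Fintype κ] [DecidableEq κ] [Fintype ι] (W : κ → ι → ℝ) : ℝ :=
  (Matrix.of W * (Matrix.of W).transpose).det

theorem continuous_gramDet {κ ι : Type*} [Fintype κ] [DecidableEq κ] [Fintype ι] :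
    Continuous (gramDet : (κ → ι → ℝ) → ℝ) := by
  unfold gramDet
  refine Continuous.matrix_det (Continuous.matrix_mul ?_ (Continuous.matrix_transpose ?_)) <;>
  exact continuous_id

theorem gramDet_eq_det_gram {κ ι : Type*} [Fintype κ] [DecidableEq κ] [Fintype ι]
    (W : κ → ι → ℝ) : gramDet W = (Matrix.gram ℝ fun i => WithLp.toLp 2 (W i)).det := by
  unfold gramDet
  congr 1
  ext i j
  simp [Matrix.gram_apply, Matrix.mul_apply, EuclideanSpace.inner_eq_star_dotProduct, dotProduct,
    mul_comm]

theorem gramDet_nonneg {κ ι : Type*} [Fintype κ] [DecidableEq κ] [Fintype ι] (W : κ → ι → ℝ) :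
    0 ≤ gramDet W := by
  rw [gramDet_eq_det_gram]
  exact (Matrix.posSemidef_gram ℝ _).det_nonneg

theorem gramDet_cons_eq_zero {s : ℕ} {ι : Type*} [Fintype ι] (w : ι → ℝ) {W : Fin s → ι → ℝ}
    (hW : gramDet W = 0) : gramDet (Fin.cons w W : Fin (s + 1) → ι → ℝ) = 0 := by
  by_contra h
  rw [gramDet_eq_det_gram, ← ne_eq, Matrix.det_gram_ne_zero_iff_linearIndependent] at h
  have h' := h.comp Fin.succ (Fin.succ_injective s)
  refine absurd hW ?_
  rw [gramDet_eq_det_gram, ← ne_eq, Matrix.det_gram_ne_zero_iff_linearIndependent]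
  exact h'

theorem exists_orthonormal_complement {s d : ℕ} {W : Fin s → Fin d → ℝ} (hW : gramDet W ≠ 0) :
    ∃ V : Matrix (Fin (d - s)) (Fin d) ℝ, s ≤ d ∧ V * V.transpose = 1 ∧
      V * (Matrix.of W).transpose = 0 := by
  rw [gramDet_eq_det_gram, Matrix.det_gram_ne_zero_iff_linearIndependent] at hW
  set S := Submodule.span ℝ (Set.range fun i => WithLp.toLp 2 (W i)) with hS
  have hs : Module.finrank ℝ S = s := by
    rw [hS, finrank_span_eq_card hW, Fintype.card_fin]
  have hadd := S.finrank_add_finrank_orthogonal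
  rw [hs, finrank_euclideanSpace, Fintype.card_fin] at hadd
  have hc : Module.finrank ℝ Sᗮ = d - s := by omega
  let b := (stdOrthonormalBasis ℝ Sᗮ).reindex (finCongr hc)
  refine ⟨Matrix.of fun i => (b i : EuclideanSpace ℝ (Fin d)).ofLp, by omega, ?_, ?_⟩
  · ext i j
    have h := orthonormal_iff_ite.1 b.orthonormal i j
    rw [Matrix.one_apply, ← h, Submodule.coe_inner, EuclideanSpace.inner_eq_star_dotProduct]
    simp [Matrix.mul_apply, dotProduct, mul_comm]
  · ext i j
    have h : inner ℝ (WithLp.toLp 2 (W j)) (b i : EuclideanSpace ℝ (Fin d)) = 0 :=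
      (Submodule.mem_orthogonal _ _).1 (b i).2 _ (Submodule.subset_span ⟨j, rfl⟩)
    rw [EuclideanSpace.inner_eq_star_dotProduct] at h
    simpa [Matrix.mul_apply, dotProduct] using h

/-- Base times height: the rows of `V` are an orthonormal basis of the orthogonal complement of the
span of `W`, so `V.mulVec w` holds the coordinates of the component of `w` orthogonal to `W`. -/
theorem gramDet_cons {s d : ℕ} {W : Fin s → Fin d → ℝ} (hW : gramDet W ≠ 0) :
    ∃ V : Matrix (Fin (d - s)) (Fin d) ℝ, V * V.transpose = 1 ∧ ∀ w : Fin d → ℝ,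
      gramDet (Fin.cons w W : Fin (s + 1) → Fin d → ℝ) = gramDet W * ∑ i, V.mulVec w i ^ 2 := by
  obtain ⟨V, hsd, hV, hVW⟩ := exists_orthonormal_complement hW
  refine ⟨V, hV, fun w => ?_⟩
  set M := Matrix.of W with hM
  set D := M * M.transpose with hD
  have hdet : gramDet W = D.det := rfl
  have hu : IsUnit D.det := isUnit_iff_ne_zero.2 hW
  have hWV : M * V.transpose = 0 := by
    rw [← Matrix.transpose_transpose M, ← Matrix.transpose_mul, hVW, Matrix.transpose_zero]
  have h1 : Matrix.fromRows V M *
      Matrix.fromCols V.transpose (M.transpose * D⁻¹) = 1 := by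
    rw [Matrix.fromRows_mul_fromCols, hV, hWV, ← Matrix.mul_assoc, hVW, ← Matrix.mul_assoc, ← hD,
      Matrix.mul_nonsing_inv _ hu, Matrix.zero_mul, Matrix.fromBlocks_one]
  -- The identity splits into the projections onto the complement and onto the row space of `M`; it
  -- is `h1` with the two factors, inverse to each other, interchanged.
  have h2 : V.transpose * V + M.transpose * D⁻¹ * M = 1 := by
    rw [← Matrix.fromCols_mul_fromRows]
    exact (Matrix.mul_eq_one_comm_of_card_eq (m := Fin (d - s) ⊕ Fin s) (n := Fin d) (R := ℝ)
      (by simp; omega)).1 h1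
  let e : Fin 1 ⊕ Fin s ≃ Fin (s + 1) := finSumFinEquiv.trans (finCongr (add_comm _ _))
  have he0 : ∀ i, e (Sum.inl i) = 0 := fun i => by
    ext; simp [e]
  have he1 : ∀ i, e (Sum.inr i) = Fin.succ i := fun i => by
    ext; simp [e]
  let R : Matrix (Fin 1) (Fin d) ℝ := Matrix.of fun _ => w
  have hblock : (Matrix.of (Fin.cons w W : Fin (s + 1) → Fin d → ℝ) *
      (Matrix.of (Fin.cons w W : Fin (s + 1) → Fin d → ℝ)).transpose).submatrix e e =
      Matrix.fromBlocks (R * R.transpose) (R * M.transpose) (M * R.transpose) D := by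
    ext i j
    rcases i with i | i <;> rcases j with j | j <;>
      simp [Matrix.mul_apply, he0, he1, R, M, D]
  have hinv : Invertible D := Matrix.invertibleOfIsUnitDet D hu
  -- The Schur complement of `D` in the enlarged Gram matrix is the squared height.
  have h3 : R * R.transpose - R * M.transpose * ⅟D * (M * R.transpose) =
      R * V.transpose * (V * R.transpose) := by
    have : R * (V.transpose * V + M.transpose * D⁻¹ * M) * R.transpose = R * R.transpose := by
      rw [h2, Matrix.mul_one]
    rw [← this, Matrix.invOf_eq_nonsing_inv]
    simp only [Matrix.mul_add, Matrix.add_mul, Matrix.mul_assoc, add_sub_cancel_right]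
  rw [gramDet, ← Matrix.det_submatrix_equiv_self e, hblock, Matrix.det_fromBlocks₂₂, h3, hdet]
  congr 1
  simp [Matrix.mul_apply, R, Matrix.mulVec, dotProduct, sq, mul_comm]

/-- With `W` fixed and independent, the height vector is a Gaussian vector in dimension `d - s`,
whatever `W` is. -/
theorem lintegral_gramDet_cons_le {s d : ℕ} (W : Fin s → Fin d → ℝ) (v : ℝ≥0) {p : ℝ} (hp : p ≠ 0)
    {B : ℝ≥0∞} (hB : B ≠ 0)
    (h : ∫⁻ x, ENNReal.ofReal (∑ i, x i ^ 2) ^ p ∂gaussPi (Fin (d - s)) v ≤ B) :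
    ∫⁻ w, ENNReal.ofReal (gramDet (Fin.cons w W : Fin (s + 1) → Fin d → ℝ)) ^ p
      ∂gaussPi (Fin d) v ≤ ENNReal.ofReal (gramDet W) ^ p * B := by
  by_cases hW : gramDet W = 0
  · simp only [gramDet_cons_eq_zero _ hW, hW, ENNReal.ofReal_zero]
    -- For negative `p` the right side is `∞ * B`, which is `∞` only because `B ≠ 0`.
    rcases hp.lt_or_gt with hp | hp
    · rw [ENNReal.zero_rpow_of_neg hp, ENNReal.top_mul hB]
      exact le_top
    · simp [ENNReal.zero_rpow_of_pos hp]
  · obtain ⟨V, hV, hcons⟩ := gramDet_cons hW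
    have hpos : 0 < gramDet W := lt_of_le_of_ne (gramDet_nonneg W) (Ne.symm hW)
    have hm : Measurable fun x : Fin (d - s) → ℝ => ENNReal.ofReal (∑ i, x i ^ 2) ^ p := by
      fun_prop
    have hmV : Measurable fun w : Fin d → ℝ => V.mulVec w :=
      (Continuous.matrix_mulVec continuous_const continuous_id).measurable
    simp_rw [hcons, ENNReal.ofReal_mul hpos.le]
    rw [← gaussPi_map_mulVec v V hV, lintegral_map hm hmV] at h
    have : ∀ w, (ENNReal.ofReal (gramDet W) * ENNReal.ofReal (∑ i, V.mulVec w i ^ 2)) ^ p =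
        ENNReal.ofReal (gramDet W) ^ p * ENNReal.ofReal (∑ i, V.mulVec w i ^ 2) ^ p := fun w =>
      ENNReal.mul_rpow_of_ne_top ENNReal.ofReal_ne_top ENNReal.ofReal_ne_top _
    simp_rw [this]
    have hc : Measurable fun w => ENNReal.ofReal (∑ i, V.mulVec w i ^ 2) ^ p := hm.comp hmV
    rw [lintegral_const_mul _ hc]
    gcongr

theorem lintegral_gramDet_le {d : ℕ} (v : ℝ≥0) {p : ℝ} (hp : p ≠ 0) {B : ℝ≥0∞} (hB : B ≠ 0)
    (s : ℕ) (h : ∀ r < s,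
      ∫⁻ x, ENNReal.ofReal (∑ i, x i ^ 2) ^ p ∂gaussPi (Fin (d - r)) v ≤ B) :
    ∫⁻ W, ENNReal.ofReal (gramDet W) ^ p ∂Measure.pi (fun _ : Fin s => gaussPi (Fin d) v) ≤
      B ^ s := by
  induction s with
  | zero => simp [gramDet]
  | succ s ih =>
    have hm : ∀ s, Measurable fun W : Fin s → Fin d → ℝ => ENNReal.ofReal (gramDet W) ^ p :=
      fun s => (continuous_gramDet.measurable.ennreal_ofReal).pow_const _
    have hmp := (measurePreserving_piFinSuccAbove
      (fun _ : Fin (s + 1) => gaussPi (Fin d) v) 0).symm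
    have hc : Measurable fun a => ENNReal.ofReal
        (gramDet ((MeasurableEquiv.piFinSuccAbove (fun _ => Fin d → ℝ) 0).symm a)) ^ p :=
      (hm (s + 1)).comp (MeasurableEquiv.measurable _)
    rw [← hmp.lintegral_comp_emb (MeasurableEquiv.measurableEmbedding _),
      lintegral_prod_symm _ hc.aemeasurable]
    calc _ ≤ ∫⁻ W, ENNReal.ofReal (gramDet W) ^ p * B
          ∂Measure.pi (fun _ : Fin s => gaussPi (Fin d) v) := by
          refine lintegral_mono fun W => ?_
          have := lintegral_gramDet_cons_le W v hp hB (h s (Nat.lt_succ_self s))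
          simpa only [MeasurableEquiv.piFinSuccAbove_symm_apply, Fin.insertNthEquiv,
            Equiv.coe_fn_mk, Fin.insertNth_zero'] using this
      _ ≤ B ^ (s + 1) := by
          rw [lintegral_mul_const _ (hm s), pow_succ]
          gcongr
          exact ih fun r hr => h r (hr.trans (Nat.lt_succ_self s))

/-! ### Gaussian projections and squared volumes -/

theorem gaussPi_map_curry {ι κ : Type*} [Fintype ι] [Fintype κ] (v : ℝ≥0) :
    (gaussPi (ι × κ) v).map (fun x i j => x (i, j)) = Measure.pi fun _ : ι => gaussPi κ v := by
  have h := Measure.infinitePi_map_curry (fun (_ : ι) (_ : κ) => gaussianReal 0 v)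
  simp only [Measure.infinitePi_eq_pi] at h
  exact h

theorem IsGaussianProjection.map_eq {Ω : Type*} [MeasurableSpace Ω] {μ : Measure Ω}
    [IsProbabilityMeasure μ] {d D : ℕ} {G : Ω → Matrix (Fin d) (Fin D) ℝ}
    (hG : IsGaussianProjection μ G) :
    μ.map (fun ω (p : Fin d × Fin D) => G ω p.1 p.2) = gaussPi (Fin d × Fin D) (1 / d) := by
  refine ((iIndepFun_iff_map_fun_eq_pi_map
    (f := fun (p : Fin d × Fin D) ω => G ω p.1 p.2) fun p => (hG.1 p.1 p.2).aemeasurable).1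
      hG.2).trans ?_
  simp_rw [fun p : Fin d × Fin D => (hG.1 p.1 p.2).map_eq]
  rfl

theorem IsGaussianProjection.aemeasurable {Ω : Type*} [MeasurableSpace Ω] {μ : Measure Ω}
    {d D : ℕ} {G : Ω → Matrix (Fin d) (Fin D) ℝ} (hG : IsGaussianProjection μ G) :
    AEMeasurable (fun ω (p : Fin d × Fin D) => G ω p.1 p.2) μ :=
  aemeasurable_pi_lambda _ fun p => (hG.1 p.1 p.2).aemeasurable

theorem measurable_mul_curry {d D s : ℕ} (Q : Matrix (Fin D) (Fin s) ℝ) :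
    Measurable fun (x : Fin d × Fin D → ℝ) (j : Fin s) (i : Fin d) => ∑ l, x (i, l) * Q l j := by
  fun_prop

theorem IsGaussianProjection.map_mul {Ω : Type*} [MeasurableSpace Ω] {μ : Measure Ω}
    [IsProbabilityMeasure μ] {d D s : ℕ} {G : Ω → Matrix (Fin d) (Fin D) ℝ}
    (hG : IsGaussianProjection μ G) {Q : Matrix (Fin D) (Fin s) ℝ} (hQ : Q.transpose * Q = 1) :
    μ.map (fun ω (j : Fin s) (i : Fin d) => (G ω * Q) i j) =
      Measure.pi fun _ : Fin s => gaussPi (Fin d) (1 / d) := by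
  -- The matrix of `G ↦ (G * Q).transpose` on flattened entries; orthonormal columns of `Q` make its
  -- rows orthonormal.
  let A : Matrix (Fin s × Fin d) (Fin d × Fin D) ℝ :=
    Matrix.of fun a b => if a.2 = b.1 then Q b.2 a.1 else 0
  have hA : A * A.transpose = 1 := by
    ext ⟨j, i⟩ ⟨j', i'⟩
    have h := congrFun (congrFun hQ j) j'
    simp only [Matrix.mul_apply, Matrix.transpose_apply] at h
    simp only [A, Matrix.mul_apply, Matrix.transpose_apply, Matrix.of_apply,
      Fintype.sum_prod_type, mul_ite, ite_mul, zero_mul, mul_zero]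
    rw [Matrix.one_apply] at h ⊢
    by_cases hi : i = i'
    · subst hi
      simpa using h
    · simp [hi]
  have hAx : ∀ (x : Fin d × Fin D → ℝ) j i, A.mulVec x (j, i) = ∑ l, x (i, l) * Q l j := by
    intro x j i
    simp only [A, Matrix.mulVec, dotProduct, Matrix.of_apply, Fintype.sum_prod_type, ite_mul,
      zero_mul]
    rw [Finset.sum_eq_single i]
    · simp [mul_comm]
    · intro b _ hb
      simp [Ne.symm hb]
    · simp
  have hmA : Measurable fun x : Fin d × Fin D → ℝ => A.mulVec x :=
    (Continuous.matrix_mulVec continuous_const continuous_id).measurable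
  rw [← gaussPi_map_curry, ← gaussPi_map_mulVec _ A hA, ← hG.map_eq,
    Measure.map_map (by fun_prop) hmA]
  simp only [Function.comp_def, hAx]
  rw [AEMeasurable.map_map_of_aemeasurable (measurable_mul_curry Q).aemeasurable hG.aemeasurable]
  rfl

-- Writing `Ψ.transpose * Ψ = B.transpose * B` with `B` invertible, `Q = Ψ * B⁻¹` has orthonormal
-- columns and `G * Ψ = (G * Q) * B`, so `B.det ^ 2` factors out.
open scoped MatrixOrder Matrix.Norms.L2Operator in
theorem exists_orthonormal_factor {D d s : ℕ} (Ψ : Matrix (Fin D) (Fin s) ℝ)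
    (hΨ : (Ψ.transpose * Ψ).det ≠ 0) :
    ∃ Q : Matrix (Fin D) (Fin s) ℝ, Q.transpose * Q = 1 ∧ ∀ G : Matrix (Fin d) (Fin D) ℝ,
      ((G * Ψ).transpose * (G * Ψ)).det =
        (Ψ.transpose * Ψ).det * gramDet (fun (j : Fin s) (i : Fin d) => (G * Q) i j) := by
  have hpsd : (Ψ.transpose * Ψ).PosSemidef := by
    simpa using Matrix.posSemidef_conjTranspose_mul_self Ψ
  obtain ⟨B, hB⟩ := CStarAlgebra.nonneg_iff_eq_star_mul_self.1 hpsd.nonneg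
  rw [Matrix.star_eq_conjTranspose] at hB
  rw [Matrix.conjTranspose_eq_transpose_of_trivial] at hB
  have hdet : (Ψ.transpose * Ψ).det = B.det ^ 2 := by
    rw [hB, Matrix.det_mul, Matrix.det_transpose, sq]
  have hu : IsUnit B.det := isUnit_iff_ne_zero.2 fun h => hΨ (by rw [hdet, h]; norm_num)
  refine ⟨Ψ * B⁻¹, ?_, fun G => ?_⟩
  · rw [Matrix.transpose_mul, Matrix.mul_assoc, ← Matrix.mul_assoc _ Ψ, hB, Matrix.mul_assoc,
      Matrix.mul_nonsing_inv _ hu, Matrix.mul_one, Matrix.transpose_nonsing_inv,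
      Matrix.nonsing_inv_mul _ (by rwa [Matrix.det_transpose])]
  · have h1 : G * Ψ = G * (Ψ * B⁻¹) * B := by
      rw [Matrix.mul_assoc, Matrix.mul_assoc, Matrix.nonsing_inv_mul _ hu, Matrix.mul_one]
    have h2 : gramDet (fun (j : Fin s) (i : Fin d) => (G * (Ψ * B⁻¹)) i j) =
        ((G * (Ψ * B⁻¹)).transpose * (G * (Ψ * B⁻¹))).det := rfl
    rw [h2, hdet, h1, Matrix.transpose_mul, Matrix.mul_assoc, ← Matrix.mul_assoc _ _ B,
      Matrix.det_mul, Matrix.det_mul, Matrix.det_transpose]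
    ring

theorem det_projection_eq_zero {D d s : ℕ} (Ψ : Matrix (Fin D) (Fin s) ℝ)
    (hΨ : (Ψ.transpose * Ψ).det = 0) (G : Matrix (Fin d) (Fin D) ℝ) :
    ((G * Ψ).transpose * (G * Ψ)).det = 0 := by
  obtain ⟨x, hx, h⟩ := Matrix.exists_mulVec_eq_zero_iff.2 hΨ
  refine Matrix.exists_mulVec_eq_zero_iff.1 ⟨x, hx, ?_⟩
  have h0 : Ψ.mulVec x = 0 := by
    have := Matrix.conjTranspose_mul_self_mulVec_eq_zero Ψ x
    rw [Matrix.conjTranspose_eq_transpose_of_trivial] at this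
    exact this.1 h
  rw [← Matrix.mulVec_mulVec, ← Matrix.mulVec_mulVec, h0, Matrix.mulVec_zero, Matrix.mulVec_zero]

/-- The squared volume spanned by the columns of `Φ` indexed by `Y`. -/
def sqVol {m ι : Type*} [Fintype m] [DecidableEq ι] (Φ : Matrix m ι ℝ) (Y : Finset ι) : ℝ :=
  ((Φ.submatrix id (fun i : Y => (i : ι))).transpose *
    Φ.submatrix id (fun i : Y => (i : ι))).det

theorem sqVol_nonneg {m ι : Type*} [Fintype m] [DecidableEq ι] (Φ : Matrix m ι ℝ) (Y : Finset ι) :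
    0 ≤ sqVol Φ Y := by
  have := Matrix.posSemidef_conjTranspose_mul_self (Φ.submatrix id (fun i : Y => (i : ι)))
  rw [Matrix.conjTranspose_eq_transpose_of_trivial] at this
  exact this.det_nonneg

theorem sqVol_eq_det {m ι : Type*} [Fintype m] [DecidableEq ι] (Φ : Matrix m ι ℝ)
    (Y : Finset ι) :
    sqVol Φ Y = ((Φ.submatrix id (fun i => (Y.equivFin.symm i : ι))).transpose *
      Φ.submatrix id (fun i => (Y.equivFin.symm i : ι))).det := by
  rw [sqVol, ← Matrix.det_submatrix_equiv_self Y.equivFin.symm]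
  congr 1

theorem sqVol_projection_eq_zero {D d : ℕ} {ι : Type*} [DecidableEq ι]
    {Φ : Matrix (Fin D) ι ℝ} {Y : Finset ι} (h : sqVol Φ Y = 0) (G : Matrix (Fin d) (Fin D) ℝ) :
    sqVol (G * Φ) Y = 0 := by
  rw [sqVol_eq_det] at h ⊢
  exact det_projection_eq_zero _ h G

/-- The moments of the distortion of a squared volume under a Gaussian projection. -/
theorem lintegral_sqVol_ratio_le {Ω : Type*} [MeasurableSpace Ω] {μ : Measure Ω}
    [IsProbabilityMeasure μ] {d D : ℕ} {ι : Type*} [DecidableEq ι]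
    {G : Ω → Matrix (Fin d) (Fin D) ℝ} (hG : IsGaussianProjection μ G) {Φ : Matrix (Fin D) ι ℝ}
    {Y : Finset ι} (hY : sqVol Φ Y ≠ 0) {p : ℝ} (hp : p ≠ 0) {B : ℝ≥0∞} (hB : B ≠ 0)
    (h : ∀ r < Y.card,
      ∫⁻ x, ENNReal.ofReal (∑ i, x i ^ 2) ^ p ∂gaussPi (Fin (d - r)) (1 / d) ≤ B) :
    AEMeasurable (fun ω => ENNReal.ofReal (sqVol (G ω * Φ) Y / sqVol Φ Y) ^ p) μ ∧
    ∫⁻ ω, ENNReal.ofReal (sqVol (G ω * Φ) Y / sqVol Φ Y) ^ p ∂μ ≤ B ^ Y.card := by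
  rw [sqVol_eq_det] at hY
  obtain ⟨Q, hQ, hdet⟩ := exists_orthonormal_factor (d := d) _ hY
  have hratio : ∀ ω, sqVol (G ω * Φ) Y / sqVol Φ Y =
      gramDet (fun (j : Fin Y.card) (i : Fin d) => (G ω * Q) i j) := fun ω => by
    rw [sqVol_eq_det, sqVol_eq_det, div_eq_iff hY, mul_comm, ← hdet]
    rfl
  have hm : Measurable fun W : Fin Y.card → Fin d → ℝ => ENNReal.ofReal (gramDet W) ^ p :=
    (continuous_gramDet.measurable.ennreal_ofReal).pow_const _
  have hGm : AEMeasurable (fun ω (j : Fin Y.card) (i : Fin d) => (G ω * Q) i j) μ :=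
    (measurable_mul_curry Q).comp_aemeasurable hG.aemeasurable
  simp_rw [hratio]
  refine ⟨hm.comp_aemeasurable hGm, ?_⟩
  rw [← lintegral_map' hm.aemeasurable hGm, hG.map_mul hQ]
  exact lintegral_gramDet_le _ hp hB _ h

/-! ### Concentration of one squared volume -/

/-- The hypotheses keep `(d - r ± 2t) / d` between `1 - ε` and `1 + 2ε`. For negative moments, `ε <
1/2` gives `1 / (1 - ε) ≤ 1 + 2ε ≤ exp (2ε)`. -/
theorem lintegral_gaussPi_rpow_le_exp {d r t : ℕ} {ε : ℝ} (hε : 0 < ε) (hε' : ε < 1 / 2)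
    (hr : 2 * r ≤ d * ε) (ht : 8 * t ≤ d * ε) (hd : d ≠ 0) {p : ℝ} (hp : p = t ∨ p = -t) :
    ∫⁻ x, ENNReal.ofReal (∑ i, x i ^ 2) ^ p ∂gaussPi (Fin (d - r)) (1 / d) ≤
      ENNReal.ofReal (Real.exp (2 * ε * t)) := by
  have hd' : (0 : ℝ) < d := by positivity
  have hrd : (r : ℝ) ≤ d := by nlinarith [(Nat.cast_nonneg r : (0 : ℝ) ≤ r)]
  have hn : ((d - r : ℕ) : ℝ) = d - r := Nat.cast_sub (by exact_mod_cast hrd)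
  have hlow : (d : ℝ) * (1 - ε) ≤ (d - r : ℕ) - 2 * t := by rw [hn]; nlinarith
  have hpos : 0 < (d : ℝ) * (1 - ε) := by nlinarith
  have hn0 : d - r ≠ 0 := fun h => by
    rw [h, Nat.cast_zero] at hlow
    linarith [(Nat.cast_nonneg t : (0 : ℝ) ≤ t)]
  have hv : (1 / d : ℝ≥0) ≠ 0 := by positivity
  have hexp : Real.exp (2 * ε * t) = Real.exp (2 * ε) ^ t := by
    rw [← Real.exp_nat_mul]; ring_nf
  have h1 := Real.add_one_le_exp (2 * ε)
  rcases hp with rfl | rfl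
  · refine (lintegral_gaussPi_rpow_natCast_le hn0 hv t).trans (ENNReal.ofReal_le_ofReal ?_)
    rw [hexp]
    refine pow_le_pow_left₀ (by positivity) (le_trans ?_ h1) t
    push_cast
    rw [hn, one_div, inv_mul_le_iff₀ hd']
    nlinarith [(Nat.cast_nonneg r : (0 : ℝ) ≤ r)]
  · have h2 : 2 * t < d - r := by
      have : (2 * t : ℝ) < (d - r : ℕ) := by linarith
      exact_mod_cast this
    refine (lintegral_gaussPi_rpow_neg_natCast_le h2 hv).trans (ENNReal.ofReal_le_ofReal ?_)
    have h3 : 1 - ε ≤ ((1 / d : ℝ≥0) : ℝ) * ((d - r : ℕ) - 2 * t) := by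
      push_cast
      rw [one_div, le_inv_mul_iff₀ hd']
      exact hlow
    have h4 : 0 < 1 - ε := by linarith
    rw [hexp]
    refine pow_le_pow_left₀ (inv_nonneg.2 (h4.le.trans h3)) (le_trans ?_ h1) t
    refine (inv_anti₀ h4 h3).trans ?_
    rw [inv_le_iff_one_le_mul₀ h4]
    nlinarith

theorem measure_sqVol_ratio_rpow_ge_le {Ω : Type*} [MeasurableSpace Ω] {μ : Measure Ω}
    [IsProbabilityMeasure μ] {d D k t : ℕ} {ι : Type*} [DecidableEq ι]
    {G : Ω → Matrix (Fin d) (Fin D) ℝ} (hG : IsGaussianProjection μ G) {Φ : Matrix (Fin D) ι ℝ}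
    {Y : Finset ι} (hY : sqVol Φ Y ≠ 0) {ε : ℝ} (hε : 0 < ε) (hε' : ε < 1 / 2) (hYk : Y.card ≤ k)
    (hk : 2 * k ≤ d * ε) (ht : 8 * t ≤ d * ε) (ht0 : t ≠ 0) (hd : d ≠ 0) {p : ℝ}
    (hp : p = t ∨ p = -t) :
    μ {ω | ENNReal.ofReal (Real.exp (3 * Y.card * ε * t)) ≤
      ENNReal.ofReal (sqVol (G ω * Φ) Y / sqVol Φ Y) ^ p} ≤
        ENNReal.ofReal (Real.exp (-(ε * t)) ^ Y.card) := by
  have ht' : (0 : ℝ) < t := by positivity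
  have hp0 : p ≠ 0 := by rcases hp with rfl | rfl <;> simp [ht0]
  obtain ⟨hm, hle⟩ := lintegral_sqVol_ratio_le hG hY hp0
    (B := ENNReal.ofReal (Real.exp (2 * ε * t))) (by simp [Real.exp_pos]) fun r hr =>
      lintegral_gaussPi_rpow_le_exp hε hε'
        ((mul_le_mul_of_nonneg_left (Nat.cast_le.2 (hr.le.trans hYk)) zero_le_two).trans hk)
        ht hd hp
  have hmarkov := (meas_ge_le_lintegral_div hm
    (ε := ENNReal.ofReal (Real.exp (3 * Y.card * ε * t))) (by simp [Real.exp_pos])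
    ENNReal.ofReal_ne_top).trans (ENNReal.div_le_div_right hle _)
  refine hmarkov.trans_eq ?_
  rw [← ENNReal.ofReal_pow (Real.exp_pos _).le, ← ENNReal.ofReal_div_of_pos (Real.exp_pos _),
    ← Real.exp_nat_mul, ← Real.exp_sub, ← Real.exp_nat_mul]
  ring_nf

/-- With high probability a Gaussian projection preserves a squared volume up to a factor. -/
theorem measure_sqVol_distorted_le {Ω : Type*} [MeasurableSpace Ω] {μ : Measure Ω}
    [IsProbabilityMeasure μ] {d D k : ℕ} {ι : Type*} [DecidableEq ι]
    {G : Ω → Matrix (Fin d) (Fin D) ℝ} (hG : IsGaussianProjection μ G) {Φ : Matrix (Fin D) ι ℝ}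
    {Y : Finset ι} (hY : sqVol Φ Y ≠ 0) {ε : ℝ} (hε : 0 < ε) (hε' : ε < 1 / 2) (hYk : Y.card ≤ k)
    (hk : 2 * k ≤ d * ε) (hd : 12 ≤ d * ε) :
    μ {ω | ¬ (sqVol Φ Y * Real.exp (-(3 * Y.card * ε)) ≤ sqVol (G ω * Φ) Y ∧
      sqVol (G ω * Φ) Y ≤ sqVol Φ Y * Real.exp (3 * Y.card * ε))} ≤
        ENNReal.ofReal (2 * Real.exp (-(d * ε ^ 2 / 24)) ^ Y.card) := by
  have hpos : 0 < sqVol Φ Y := lt_of_le_of_ne (sqVol_nonneg _ _) (Ne.symm hY)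
  -- The largest order allowed by `8t ≤ dε`. As `dε ≥ 12`, rounding down costs at most a factor 3,
  -- whence the constant 24.
  set t : ℕ := ⌊d * ε / 8⌋₊ with ht
  have ht8 : 8 * (t : ℝ) ≤ d * ε := by
    have := Nat.floor_le (show 0 ≤ d * ε / 8 by positivity)
    linarith
  have ht24 : d * ε / 24 ≤ t := by
    have := Nat.lt_floor_add_one (d * ε / 8)
    linarith
  have ht0 : t ≠ 0 := fun h => by
    rw [h, Nat.cast_zero] at ht24
    linarith
  have ht' : (0 : ℝ) < t := by positivity
  have hd0 : d ≠ 0 := by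
    rintro rfl
    norm_num at hd
  have hsub : {ω | ¬ (sqVol Φ Y * Real.exp (-(3 * Y.card * ε)) ≤ sqVol (G ω * Φ) Y ∧
      sqVol (G ω * Φ) Y ≤ sqVol Φ Y * Real.exp (3 * Y.card * ε))} ⊆
      {ω | ENNReal.ofReal (Real.exp (3 * Y.card * ε * t)) ≤
        ENNReal.ofReal (sqVol (G ω * Φ) Y / sqVol Φ Y) ^ (-t : ℝ)} ∪
      {ω | ENNReal.ofReal (Real.exp (3 * Y.card * ε * t)) ≤
        ENNReal.ofReal (sqVol (G ω * Φ) Y / sqVol Φ Y) ^ (t : ℝ)} := by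
    intro ω hω
    rw [Set.mem_ofPred_eq, not_and_or, not_le, not_le] at hω
    rcases hω with hω | hω
    -- Volumes that are too small are caught by the negative moment.
    · left
      have h1 : sqVol (G ω * Φ) Y / sqVol Φ Y ≤ Real.exp (-(3 * Y.card * ε)) := by
        rw [div_le_iff₀ hpos, mul_comm]
        exact hω.le
      have h2 : Real.exp (3 * Y.card * ε * t) = Real.exp (-(3 * Y.card * ε)) ^ (-t : ℝ) := by
        rw [← Real.exp_mul]; ring_nf
      rw [Set.mem_ofPred_eq, h2, ← ENNReal.ofReal_rpow_of_pos (Real.exp_pos _)]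
      rw [ENNReal.rpow_neg, ENNReal.rpow_neg, ENNReal.inv_le_inv]
      exact ENNReal.rpow_le_rpow (ENNReal.ofReal_le_ofReal h1) ht'.le
    · right
      have h1 : Real.exp (3 * Y.card * ε) ≤ sqVol (G ω * Φ) Y / sqVol Φ Y := by
        rw [le_div_iff₀ hpos, mul_comm]
        exact hω.le
      rw [Set.mem_ofPred_eq, Real.exp_mul, ← ENNReal.ofReal_rpow_of_pos (Real.exp_pos _)]
      exact ENNReal.rpow_le_rpow (ENNReal.ofReal_le_ofReal h1) ht'.le
  have hexp : Real.exp (-(ε * t)) ^ Y.card ≤ Real.exp (-(d * ε ^ 2 / 24)) ^ Y.card := by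
    refine pow_le_pow_left₀ (Real.exp_pos _).le (Real.exp_le_exp.2 ?_) _
    nlinarith
  refine (measure_mono hsub).trans ((measure_union_le _ _).trans ?_)
  rw [two_mul, ENNReal.ofReal_add (by positivity) (by positivity)]
  exact add_le_add
    ((measure_sqVol_ratio_rpow_ge_le hG hY hε hε' hYk hk ht8 ht0 hd0 (.inr rfl)).trans
      (ENNReal.ofReal_le_ofReal hexp))
    ((measure_sqVol_ratio_rpow_ge_le hG hY hε hε' hYk hk ht8 ht0 hd0 (.inl rfl)).trans
      (ENNReal.ofReal_le_ofReal hexp))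

/-! ### From weights to conditioned distributions -/

theorem weight_eq {m ι : Type*} [Fintype m] [DecidableEq ι] (q : ι → ℝ) (Φ : Matrix m ι ℝ)
    (Y : Finset ι) : weight q Φ Y = (∏ i ∈ Y, q i ^ 2) * sqVol Φ Y :=
  rfl

theorem sqVol_empty {m ι : Type*} [Fintype m] [DecidableEq ι] (Φ : Matrix m ι ℝ) :
    sqVol Φ ∅ = 1 :=
  Matrix.det_isEmpty

theorem weight_nonneg {m ι : Type*} [Fintype m] [DecidableEq ι] (q : ι → ℝ) (Φ : Matrix m ι ℝ)
    (Y : Finset ι) : 0 ≤ weight q Φ Y :=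
  mul_nonneg (Finset.prod_nonneg fun _ _ => sq_nonneg _) (sqVol_nonneg Φ Y)

theorem sum_weight_pos {m ι : Type*} [Fintype m] [Fintype ι] [DecidableEq ι] (k : ℕ) (q : ι → ℝ)
    (Φ : Matrix m ι ℝ) : 0 < ∑ Y : Finset ι with Y.card ≤ k, weight q Φ Y :=
  Finset.sum_pos' (fun _ _ => weight_nonneg q Φ _)
    ⟨∅, by simp, by simp [weight_eq, sqVol_empty]⟩

theorem sum_condDPP {m ι : Type*} [Fintype m] [Fintype ι] [DecidableEq ι] (k : ℕ) (q : ι → ℝ)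
    (Φ : Matrix m ι ℝ) : ∑ Y, condDPP k q Φ Y = 1 := by
  simp_rw [condDPP_eq]
  rw [← Finset.sum_filter, ← Finset.sum_div, div_self (sum_weight_pos k q Φ).ne']

/-- Weights that agree up to a factor give close conditioned distributions. -/
theorem l1Dist_condDPP_le {m m' ι : Type*} [Fintype m] [Fintype m'] [Fintype ι] [DecidableEq ι]
    {k : ℕ} {q : ι → ℝ} {Φ : Matrix m ι ℝ} {Ψ : Matrix m' ι ℝ} {a : ℝ}
    (hlow : ∀ Y : Finset ι, Y.card ≤ k → weight q Φ Y * Real.exp (-a) ≤ weight q Ψ Y)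
    (hup : ∀ Y : Finset ι, Y.card ≤ k → weight q Ψ Y ≤ weight q Φ Y * Real.exp a) :
    l1Dist (condDPP k q Φ) (condDPP k q Ψ) ≤ Real.exp (2 * a) - 1 := by
  have hZ := sum_weight_pos k q Φ
  have hZ' := sum_weight_pos k q Ψ
  have hsl : (∑ Y : Finset ι with Y.card ≤ k, weight q Φ Y) * Real.exp (-a) ≤
      ∑ Y : Finset ι with Y.card ≤ k, weight q Ψ Y := by
    rw [Finset.sum_mul]
    exact Finset.sum_le_sum fun Y hY => hlow Y (Finset.mem_filter.1 hY).2
  have hsu : ∑ Y : Finset ι with Y.card ≤ k, weight q Ψ Y ≤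
      (∑ Y : Finset ι with Y.card ≤ k, weight q Φ Y) * Real.exp a := by
    rw [Finset.sum_mul]
    exact Finset.sum_le_sum fun Y hY => hup Y (Finset.mem_filter.1 hY).2
  have hE : Real.exp (2 * a) = Real.exp a * Real.exp a := by rw [← Real.exp_add]; ring_nf
  have hE' : Real.exp (-a) * Real.exp a = 1 := by rw [← Real.exp_add]; simp
  have hea := Real.exp_pos a
  have hea' := Real.exp_pos (-a)
  -- The error is relative to the first distribution, whose total mass 1 makes the bounds sum to the
  -- claim.
  have key : ∀ Y, |condDPP k q Φ Y - condDPP k q Ψ Y| ≤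
      condDPP k q Φ Y * (Real.exp (2 * a) - 1) := by
    intro Y
    rw [condDPP_eq, condDPP_eq]
    split_ifs with hY
    · set w := weight q Φ Y
      set w' := weight q Ψ Y
      set Z := ∑ Y : Finset ι with Y.card ≤ k, weight q Φ Y
      set Z' := ∑ Y : Finset ι with Y.card ≤ k, weight q Ψ Y
      have hw : 0 ≤ w := weight_nonneg q Φ Y
      have hw' : 0 ≤ w' := weight_nonneg q Ψ Y
      have h1 : w' / Z' ≤ w / Z * Real.exp (2 * a) := by
        rw [div_mul_eq_mul_div, div_le_div_iff₀ hZ' hZ]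
        calc w' * Z ≤ (w * Real.exp a) * (Z' * Real.exp a) :=
              mul_le_mul (hup Y hY) (by nlinarith) hZ.le (by positivity)
          _ = w * Real.exp (2 * a) * Z' := by rw [hE]; ring
      have h2 : w / Z ≤ w' / Z' * Real.exp (2 * a) := by
        rw [div_mul_eq_mul_div, div_le_div_iff₀ hZ hZ']
        calc w * Z' ≤ (w' * Real.exp a) * (Z * Real.exp a) :=
              mul_le_mul (by nlinarith [hlow Y hY]) hsu hZ'.le (by positivity)
          _ = w' * Real.exp (2 * a) * Z := by rw [hE]; ring
      have h3 : 0 ≤ w / Z := by positivity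
      have hEpos : 0 < Real.exp (2 * a) := Real.exp_pos _
      rw [abs_le]
      constructor
      · linarith
      · have h4 : w / Z - w / Z * (Real.exp (2 * a) - 1) ≤ w / Z * Real.exp (-(2 * a)) := by
          -- This is `2 - x ≤ 1 / x` at `x = exp (2a)`: the downward relative error `1 - 1 / x` is
          -- at most the upward one `x - 1`.
          have h5 : 2 - Real.exp (2 * a) ≤ Real.exp (-(2 * a)) := by
            rw [Real.exp_neg, ← sub_nonneg]
            have : (Real.exp (2 * a))⁻¹ - (2 - Real.exp (2 * a)) =
                (Real.exp (2 * a) - 1) ^ 2 / Real.exp (2 * a) := by field_simp; ring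
            rw [this]
            positivity
          nlinarith
        have h6 : w / Z * Real.exp (-(2 * a)) ≤ w' / Z' := by
          rw [Real.exp_neg, ← div_eq_mul_inv, div_le_iff₀ hEpos]
          exact h2
        linarith
    · simp
  calc l1Dist (condDPP k q Φ) (condDPP k q Ψ)
      ≤ ∑ Y, condDPP k q Φ Y * (Real.exp (2 * a) - 1) := Finset.sum_le_sum fun Y _ => key Y
    _ = Real.exp (2 * a) - 1 := by rw [← Finset.sum_mul, sum_condDPP, one_mul]

/-! ### Union bound and projection dimension -/

/-- The binomial theorem gives `(1 + y)^N - 1 ≤ exp u - 1`, and `exp (-u) ≥ 1 - u` does the rest. -/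
theorem sum_nonempty_pow_card_le (N : ℕ) {y u : ℝ} (hy : 0 ≤ y) (hyu : y * N ≤ u) (hu : u < 1) :
    ∑ Y : Finset (Fin N) with Y.Nonempty, y ^ Y.card ≤ u / (1 - u) := by
  have h1 : ∑ Y : Finset (Fin N), y ^ Y.card = (y + 1) ^ N := by
    have := Finset.sum_pow_mul_eq_add_pow y 1 (Finset.univ : Finset (Fin N))
    simpa using this
  have h2 : ∑ Y : Finset (Fin N), y ^ Y.card =
      ∑ Y : Finset (Fin N) with Y.Nonempty, y ^ Y.card + 1 := by
    rw [← Finset.sum_filter_add_sum_filter_not Finset.univ (fun Y => Y.Nonempty)]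
    congr 1
    simp [Finset.filter_eq']
  have h3 : (y + 1) ^ N ≤ Real.exp u := by
    calc (y + 1) ^ N ≤ Real.exp y ^ N :=
          pow_le_pow_left₀ (by positivity) (Real.add_one_le_exp y) N
      _ = Real.exp (y * N) := by rw [← Real.exp_nat_mul, mul_comm]
      _ ≤ Real.exp u := Real.exp_le_exp.2 hyu
  have h4 : Real.exp u ≤ 1 / (1 - u) := by
    rw [le_div_iff₀ (by linarith), ← le_div_iff₀' (Real.exp_pos u), one_div, ← Real.exp_neg]
    linarith [Real.add_one_le_exp (-u)]
  have h5 : 1 / (1 - u) - 1 = u / (1 - u) := by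
    have : 1 - u ≠ 0 := by linarith
    field_simp
    ring
  linarith

/-- Expanding the product of logarithms leaves the left side plus a positive quotient; that quotient
and `k - 1 ≥ 0` are dropped. The logarithms give `yN ≤ δ/3` in the union bound, and the extra 1
gives `24 ≤ dε²`, hence `12 ≤ dε`. -/
theorem log_add_log_le_of_projDim_le {N k d : ℕ} {ε δ : ℝ} (hk : 1 ≤ k) (hN : 2 ≤ N) (hε : 0 < ε)
    (hδ : 0 < δ) (hδ' : δ < 1 / 2) (hd : projDim N k ε δ ≤ d) :
    Real.log (3 / δ) + Real.log N + 1 ≤ d * ε ^ 2 / 24 := by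
  have hx : 0 < Real.log N := Real.log_pos (by exact_mod_cast hN)
  have hl : 0 < Real.log (3 / δ) := Real.log_pos (by rw [lt_div_iff₀ hδ]; linarith)
  have h1 := (le_max_right _ _).trans hd
  have hk' : (1 : ℝ) ≤ k := by exact_mod_cast hk
  have h2 : Real.log (3 / δ) + Real.log N + 1 ≤
      (Real.log (3 / δ) / Real.log N + 1) * (Real.log N + 1) := by
    have : (Real.log (3 / δ) / Real.log N + 1) * (Real.log N + 1) =
        Real.log (3 / δ) + Real.log N + 1 + Real.log (3 / δ) / Real.log N := by
      field_simp
      ring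
    rw [this]
    linarith [div_pos hl hx]
  have h3 : 24 / ε ^ 2 * ((Real.log (3 / δ) / Real.log N + 1) * (Real.log N + 1)) ≤ d := by
    rw [← mul_assoc]
    linarith
  rw [div_mul_eq_mul_div, div_le_iff₀ (by positivity)] at h3
  linarith

theorem l1Dist_condDPP_projection_le {Ω : Type*} [MeasurableSpace Ω] {μ : Measure Ω}
    [IsProbabilityMeasure μ] {N k d D : ℕ} {ε δ : ℝ} (hk : 1 ≤ k) (hN : 2 ≤ N) (hε : 0 < ε)
    (hε' : ε < 1 / 2) (hδ : 0 < δ) (hδ' : δ < 1 / 2) (hd : projDim N k ε δ ≤ d) (q : Fin N → ℝ)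
    (Φ : Matrix (Fin D) (Fin N) ℝ) {G : Ω → Matrix (Fin d) (Fin D) ℝ}
    (hG : IsGaussianProjection μ G) :
    1 - δ ≤ μ.real {ω | l1Dist (condDPP k q Φ) (condDPP k q (G ω * Φ)) ≤
      Real.exp (6 * k * ε) - 1} := by
  classical
  have hN0 : (0 : ℝ) < N := by exact_mod_cast (by omega : 0 < N)
  have hlog := log_add_log_le_of_projDim_le hk hN hε hδ hδ' hd
  have hx : 0 < Real.log N := Real.log_pos (by exact_mod_cast hN)
  have hl : 0 < Real.log (3 / δ) := Real.log_pos (by rw [lt_div_iff₀ hδ]; linarith)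
  have hkd : 2 * (k : ℝ) ≤ d * ε := by
    have := (le_max_left _ _).trans hd
    rwa [div_le_iff₀ hε] at this
  have hd12 : 12 ≤ d * ε := by
    have h1 : 24 ≤ d * ε ^ 2 := by linarith
    nlinarith [show 0 ≤ d * ε by positivity]
  set y : ℝ := Real.exp (-(d * ε ^ 2 / 24)) with hy
  have hyN : y * N ≤ δ / 3 := by
    have : y ≤ Real.exp (-(Real.log (3 / δ) + Real.log N)) := Real.exp_le_exp.2 (by linarith)
    rw [neg_add, Real.exp_add, Real.exp_neg, Real.exp_neg, Real.exp_log hN0,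
      Real.exp_log (by positivity), inv_div, ← div_eq_mul_inv, le_div_iff₀ hN0] at this
    exact this
  set S : Finset (Finset (Fin N)) :=
    Finset.univ.filter fun Y => Y.Nonempty ∧ Y.card ≤ k ∧ sqVol Φ Y ≠ 0 with hS
  set bad : Finset (Fin N) → Set Ω := fun Y =>
    {ω | ¬ (sqVol Φ Y * Real.exp (-(3 * Y.card * ε)) ≤ sqVol (G ω * Φ) Y ∧
      sqVol (G ω * Φ) Y ≤ sqVol Φ Y * Real.exp (3 * Y.card * ε))} with hbad
  have hsum : ∑ Y ∈ S, 2 * y ^ Y.card ≤ δ := by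
    have h1 : ∑ Y ∈ S, y ^ Y.card ≤ ∑ Y : Finset (Fin N) with Y.Nonempty, y ^ Y.card := by
      refine Finset.sum_le_sum_of_subset_of_nonneg (fun Y hY => ?_) fun _ _ _ => by positivity
      simp only [hS, Finset.mem_filter] at hY ⊢
      exact ⟨hY.1, hY.2.1⟩
    have h2 := sum_nonempty_pow_card_le N (Real.exp_pos _).le hyN (by linarith)
    -- Since `δ < 1`, the denominator is at least `2/3`; the factor 2 for the two tails then brings
    -- the total to `δ`.
    have h3 : δ / 3 / (1 - δ / 3) ≤ δ / 2 := by
      rw [div_le_iff₀ (by linarith)]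
      nlinarith
    rw [← Finset.mul_sum]
    linarith
  have hmeas : μ (⋃ Y ∈ S, bad Y) ≤ ENNReal.ofReal δ := by
    calc μ (⋃ Y ∈ S, bad Y) ≤ ∑ Y ∈ S, μ (bad Y) := measure_biUnion_finset_le _ _
      _ ≤ ∑ Y ∈ S, ENNReal.ofReal (2 * y ^ Y.card) := by
        refine Finset.sum_le_sum fun Y hY => ?_
        simp only [hS, Finset.mem_filter] at hY
        exact measure_sqVol_distorted_le hG hY.2.2.2 hε hε' hY.2.2.1 hkd hd12
      _ = ENNReal.ofReal (∑ Y ∈ S, 2 * y ^ Y.card) :=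
        (ENNReal.ofReal_sum_of_nonneg fun _ _ => by positivity).symm
      _ ≤ ENNReal.ofReal δ := ENNReal.ofReal_le_ofReal hsum
  have hgood : (⋃ Y ∈ S, bad Y)ᶜ ⊆ {ω | l1Dist (condDPP k q Φ) (condDPP k q (G ω * Φ)) ≤
      Real.exp (6 * k * ε) - 1} := by
    intro ω hω
    have hvol : ∀ Y : Finset (Fin N), Y.card ≤ k →
        sqVol Φ Y * Real.exp (-(3 * k * ε)) ≤ sqVol (G ω * Φ) Y ∧
        sqVol (G ω * Φ) Y ≤ sqVol Φ Y * Real.exp (3 * k * ε) := by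
      intro Y hYk
      have hYk' : 3 * (Y.card : ℝ) * ε ≤ 3 * k * ε := by
        have : (Y.card : ℝ) ≤ k := by exact_mod_cast hYk
        gcongr
      have h0 := sqVol_nonneg Φ Y
      by_cases hY0 : sqVol Φ Y = 0
      · simp [hY0, sqVol_projection_eq_zero hY0]
      have hmono : sqVol Φ Y * Real.exp (-(3 * Y.card * ε)) ≤ sqVol (G ω * Φ) Y ∧
          sqVol (G ω * Φ) Y ≤ sqVol Φ Y * Real.exp (3 * Y.card * ε) := by
        rcases Y.eq_empty_or_nonempty with rfl | hne
        · simp [sqVol_empty]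
        · by_contra hcon
          exact hω (Set.mem_biUnion (x := Y) (by simp [hS, hne, hYk, hY0]) hcon)
      refine ⟨le_trans ?_ hmono.1, hmono.2.trans ?_⟩
      · exact mul_le_mul_of_nonneg_left (Real.exp_le_exp.2 (by linarith)) h0
      · exact mul_le_mul_of_nonneg_left (Real.exp_le_exp.2 hYk') h0
    have hq : ∀ Y : Finset (Fin N), 0 ≤ ∏ i ∈ Y, q i ^ 2 := fun Y =>
      Finset.prod_nonneg fun _ _ => sq_nonneg _
    have h := l1Dist_condDPP_le (k := k) (q := q) (Φ := Φ) (Ψ := G ω * Φ) (a := 3 * k * ε)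
      (fun Y hY => by
        rw [weight_eq, weight_eq, mul_assoc]
        exact mul_le_mul_of_nonneg_left (hvol Y hY).1 (hq Y))
      (fun Y hY => by
        rw [weight_eq, weight_eq, mul_assoc]
        exact mul_le_mul_of_nonneg_left (hvol Y hY).2 (hq Y))
    rwa [show 2 * (3 * k * ε) = 6 * k * ε by ring] at h
  have hbadr : μ.real (⋃ Y ∈ S, bad Y) ≤ δ := ENNReal.toReal_le_of_le_ofReal hδ.le hmeas
  -- Subadditivity suffices here, so the bad event need not be shown measurable.
  have huniv : (1 : ℝ) ≤ μ.real (⋃ Y ∈ S, bad Y) + μ.real (⋃ Y ∈ S, bad Y)ᶜ := by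
    have := measureReal_union_le (μ := μ) (⋃ Y ∈ S, bad Y) (⋃ Y ∈ S, bad Y)ᶜ
    rwa [Set.union_compl_self, probReal_univ] at this
  have := measureReal_mono (μ := μ) hgood
  linarith

theorem ceil_projDim_le {N k : ℕ} {ε δ : ℝ} (hkN : k < N) (hε : 0 < ε) (hε' : ε < 1 / 2)
    (hδ : 0 < δ) (hδ' : δ < 1 / 2) :
    (⌈projDim N k ε δ⌉₊ : ℝ) ≤
      300 * max (k / ε) ((Real.log (1 / δ) + Real.log N) / ε ^ 2) := by
  have hlog2 := Real.log_two_gt_d9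
  have hL : Real.log 2 ≤ Real.log (1 / δ) :=
    Real.log_le_log (by norm_num) (by rw [le_div_iff₀ hδ]; linarith)
  have hlog3 : Real.log 3 ≤ 2 * Real.log 2 := by
    rw [← Real.log_rpow two_pos]
    exact Real.log_le_log (by norm_num) (by norm_num)
  have hl : Real.log (3 / δ) = Real.log 3 + Real.log (1 / δ) := by
    rw [← Real.log_mul (by norm_num) (by positivity), mul_one_div]
  set L := Real.log (1 / δ)
  have hx : 0 ≤ Real.log N := Real.log_natCast_nonneg N
  have hε2 : 0 < ε ^ 2 := by positivity
  have hε21 : ε ^ 2 ≤ 1 := by nlinarith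
  have hM1 := le_max_left ((k : ℝ) / ε) ((L + Real.log N) / ε ^ 2)
  have hM2 := le_max_right ((k : ℝ) / ε) ((L + Real.log N) / ε ^ 2)
  set M := max ((k : ℝ) / ε) ((L + Real.log N) / ε ^ 2)
  have hkε : (k : ℝ) ≤ k / ε := by
    rw [le_div_iff₀ hε]
    nlinarith [(Nat.cast_nonneg k : (0 : ℝ) ≤ k)]
  have hprod : (Real.log (3 / δ) / Real.log N + 1) * (Real.log N + 1) ≤ 11 * (L + Real.log N) := by
    have hl3 : Real.log (3 / δ) ≤ 3 * L := by linarith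
    -- If `N = 1`, division by `log 1 = 0` gives 0 and the product is 1. Otherwise `log N ≥ log 2`
    -- bounds the quotient by `5L`, and `3L + 5L + 1 ≤ 11L`.
    rcases hx.eq_or_lt with h0 | hx
    · rw [← h0]
      norm_num
      linarith
    · have hx2 : Real.log 2 ≤ Real.log N := by
        refine Real.log_le_log two_pos ?_
        have : 1 < N := by
          by_contra h
          interval_cases N <;> simp at hx
        exact_mod_cast this
      have h1 : Real.log (3 / δ) / Real.log N ≤ 5 * L := by
        rw [div_le_iff₀ hx]
        nlinarith
      have : (Real.log (3 / δ) / Real.log N + 1) * (Real.log N + 1) =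
          Real.log (3 / δ) + Real.log N + 1 + Real.log (3 / δ) / Real.log N := by
        field_simp
        ring
      rw [this]
      linarith
  have h24 : 24 / ε ^ 2 * (Real.log (3 / δ) / Real.log N + 1) * (Real.log N + 1) ≤ 264 * M := by
    rw [mul_assoc, div_mul_eq_mul_div]
    calc 24 * ((Real.log (3 / δ) / Real.log N + 1) * (Real.log N + 1)) / ε ^ 2
        ≤ 24 * (11 * (L + Real.log N)) / ε ^ 2 := by gcongr
      _ = 264 * ((L + Real.log N) / ε ^ 2) := by ring
      _ ≤ 264 * M := by linarith
  have hM : 1 ≤ 2 * M := by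
    have : L + Real.log N ≤ (L + Real.log N) / ε ^ 2 := by
      rw [le_div_iff₀ hε2]
      nlinarith
    linarith
  -- The logarithmic term costs `264 = 24 * 11` and `k - 1` at most one more `M`; rounding up costs
  -- at most `2M`, so 300 leaves room to spare.
  have hproj : projDim N k ε δ ≤ 298 * M := by
    refine max_le ?_ (by linarith)
    rw [mul_div_assoc]
    linarith
  have h0 : 0 ≤ projDim N k ε δ := (by positivity : 0 ≤ 2 * k / ε).trans (le_max_left _ _)
  linarith [Nat.ceil_lt_add_one h0]

end DPP

end

theorem mainTheorem5 :
    ∃ C : ℝ, 0 < C ∧ ∀ (N k : ℕ) (ε δ : ℝ), k < N → 0 < ε → ε < 1 / 2 → 0 < δ → δ < 1 / 2 →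
      ((⌈DPP.projDim N k ε δ⌉₊ : ℝ) ≤
          C * max (k / ε) ((Real.log (1 / δ) + Real.log N) / ε ^ 2)) ∧
      ∀ (D d : ℕ) (q : Fin N → ℝ) (Φ : Matrix (Fin D) (Fin N) ℝ),
        (∀ i, 0 ≤ q i) → DPP.projDim N k ε δ ≤ d →
        ∀ {Ω : Type*} [MeasurableSpace Ω] (μ : Measure Ω) [IsProbabilityMeasure μ]
          (G : Ω → Matrix (Fin d) (Fin D) ℝ), DPP.IsGaussianProjection μ G →
          1 - δ ≤ μ.real {ω | DPP.l1Dist (DPP.condDPP k q Φ) (DPP.condDPP k q (G ω * Φ)) ≤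
            Real.exp (6 * k * ε) - 1} := by
  refine ⟨300, by norm_num, fun N k ε δ hkN hε hε' hδ hδ' =>
    ⟨DPP.ceil_projDim_le hkN hε hε' hδ hδ', fun D d q Φ _ hd Ω _ μ _ G hG => ?_⟩⟩
  -- For `k = 0` both processes are concentrated on the empty set. For `k ≥ 1`, `k < N` forces `N ≥
  -- 2`, so that `log N > 0`.
  rcases Nat.eq_zero_or_pos k with rfl | hk
  · have h : ∀ ω, DPP.l1Dist (DPP.condDPP 0 q Φ) (DPP.condDPP 0 q (G ω * Φ)) ≤
        Real.exp (6 * (0 : ℕ) * ε) - 1 := fun ω => by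
      have hw : ∀ Y : Finset (Fin N), Y.card ≤ 0 →
          DPP.weight q (G ω * Φ) Y = DPP.weight q Φ Y := fun Y hY => by
        obtain rfl := Finset.card_eq_zero.1 (Nat.le_zero.1 hY)
        rw [DPP.weight_eq, DPP.weight_eq, DPP.sqVol_empty, DPP.sqVol_empty]
      have := DPP.l1Dist_condDPP_le (k := 0) (q := q) (Φ := Φ) (Ψ := G ω * Φ) (a := 0)
        (fun Y hY => by simp [hw Y hY]) (fun Y hY => by simp [hw Y hY])
      simpa using this
    simp only [h, Set.ofPred_true, probReal_univ]
    linarith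
  · exact DPP.l1Dist_condDPP_projection_le hk (by omega) hε hε' hδ hδ' hd q Φ hG
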